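/- **Setting.** Let $\Theta\subset\mathbb R^d$ and let $(p_\vartheta)_{\vartheta\in\Theta}$ be probability densities on $(0,\infty)$ such that each $p_\vartheta$ is positive and continuously differentiable on $(0,\infty)$ and, with $P_\vartheta(x)=\int_0^x p_\vartheta(y)\,dy$, $$\int_0^\infty |x|\,|p_\vartheta'(x)|\,dx<\infty,\qquad \sup_{x>0}\frac{p_\vartheta'(x)\min\{P_\vartheta(x),1-P_\vartheta(x)\}}{p_\vartheta(x)^2}<\infty,\qquad \lim_{x\searrow0}\frac{P_\vartheta(x)}{p_\vartheta(x)}=0 .$$ Let $\vartheta_0\in\Theta$ be identifiable: $p_\vartheta=p_{\vartheta_0}$ on $(0,\infty)$ only for $\vartheta=\vartheta_0$. Let $X_1,X_2,\dots$ be i.i.d. random variables with density $p_{\vartheta_0}$ on a complete probability space $(\Omega,\mathcal F,\mathbb P)$, and let $X$ have density $p_{\vartheta_0}$. Let $1\le q<\infty$, let $w$ be a positive, integrable function on $(0,\infty)$, and put $\|f\|_{L^q}=\big(\int_0^\infty|f(t)|^q w(t)\,dt\big)^{1/q}$. For $n\ge1$, $t>0$, $\vartheta\in\Theta$ let $$\eta_n(t,\vartheta)=-\frac1n\sum_{j=1}^n\frac{p_\vartheta'(X_j)}{p_\vartheta(X_j)}\min\{X_j,t\}-\frac1n\sum_{j=1}^n\mathbf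 1\{X_j\le t\}.$$ Assume: * (R1) $\Theta\ni\vartheta\mapsto p_\vartheta'(x)/p_\vartheta(x)$ is continuous for every $x>0$; * (R2) $\Theta$ is a nonempty Borel subset of $\mathbb R^d$; * (R3) for each nonempty compact $K\subset\Theta$ there are $0<\alpha<\infty$ and a measurable $H:(0,\infty)\to[0,\infty)$ with $\mathbb E[H(X)X]<\infty$ such that $$\left|\frac{p_{\vartheta_2}'(x)}{p_{\vartheta_2}(x)}-\frac{p_{\vartheta_1}'(x)}{p_{\vartheta_1}(x)}\right|\le H(x)\,|\vartheta_2-\vartheta_1|^\alpha\qquad(x>0,\ \vartheta_1,\vartheta_2\in K).$$ Let $\varepsilon_n$ be positive random variables with $\varepsilon_n\to0$ almost surely, and let $\widehat\vartheta_{n,q}:\Omega\to\Theta$ be measurable maps such that, for every $n\ge1$, almost surely $$\|\eta_n(\cdot,\widehat\vartheta_{n,q})\|_{L^q}\le\inf_{\vartheta\in\Theta}\|\eta_n(\cdot,\vartheta)\|_{L^q}+\varepsilon_n .$$ **Theorem 4.2 (Consistency).** (i) If the sequence $(\widehat\vartheta_{n,q})_{n\ge1}$ is tight in $\Theta$ (for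 every $\delta>0$ there is a compact $K\subset\Theta$ with $\sup_{n\ge1}\mathbb P(\widehat\vartheta_{n,q}\notin K)\le\delta$), then $\widehat\vartheta_{n,q}\to\vartheta_0$ in probability as $n\to\infty$. (ii) If $\Theta$ is compact, then $\widehat\vartheta_{n,q}\to\vartheta_0$ almost surely as $n\to\infty$. -/

import Mathlib

open MeasureTheory ProbabilityTheory Filter Topology Set

noncomputable section

/-- The probability law on the positive half axis with Lebesgue density `p` on `(0, ∞)`. -/
def halfLineLaw (p : ℝ → ℝ) : Measure ℝ :=
  (volume.restrict (Ioi (0 : ℝ))).withDensity (fun x => ENNReal.ofReal (p x))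

/-- The distribution function `P(x) = ∫₀ˣ p(y) dy`, `x > 0`, of the density `p` on `(0, ∞)`. -/
def halfLineCDF (p : ℝ → ℝ) (x : ℝ) : ℝ := ∫ y in (0 : ℝ)..x, p y

/-- The standing assumptions on a density `p` of the model. Only the values of `p` on the open
set `(0, ∞)` matter. -/
structure IsAdmissibleDensity (p : ℝ → ℝ) : Prop where
  pos : ∀ x, 0 < x → 0 < p x
  contDiffOn : ContDiffOn ℝ 1 p (Ioi 0)
  integrableOn : IntegrableOn p (Ioi 0)
  integral_eq_one : ∫ x in Ioi (0 : ℝ), p x = 1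
  integrableOn_mul_deriv : IntegrableOn (fun x => |x| * |deriv p x|) (Ioi 0)
  /-- The supremum over `x > 0` of `p'(x) min{P(x), 1 - P(x)} / p(x)²` is finite. -/
  bddAbove : BddAbove ((fun x => deriv p x * min (halfLineCDF p x) (1 - halfLineCDF p x) / p x ^ 2)
    '' Ioi 0)
  tendsto_zero : Tendsto (fun x => halfLineCDF p x / p x) (𝓝[>] 0) (𝓝 0)

/-- The logarithmic derivative `p'(x) / p(x)` of a density. -/
def scoreQuot (p : ℝ → ℝ) (x : ℝ) : ℝ := deriv p x / p x

/-- The empirical discrepancy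
`- (1/n) ∑ⱼ (p'(Xⱼ)/p(Xⱼ)) min{Xⱼ, t} - (1/n) ∑ⱼ 1{Xⱼ ≤ t}`
at the point `t`, for the density `p` and the first `n` entries of the sample `x`. -/
def empiricalEta (p : ℝ → ℝ) (x : ℕ → ℝ) (n : ℕ) (t : ℝ) : ℝ :=
  -((1 / (n : ℝ)) * ∑ j ∈ Finset.range n, scoreQuot p (x j) * min (x j) t)
    - (1 / (n : ℝ)) * ∑ j ∈ Finset.range n, (Ici (x j)).indicator (fun _ => (1 : ℝ)) t

/-- The norm `(∫₀^∞ |f(t)|^q w(t) dt)^(1/q)` of `L^q((0, ∞), w(t) dt)`. -/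
def weightedLqNorm (q : ℝ) (w : ℝ → ℝ) (f : ℝ → ℝ) : ℝ :=
  (∫ t in Ioi (0 : ℝ), |f t| ^ q * w t) ^ (1 / q)

/-- The objective function `ψ(θ) = ‖η_n(·, θ)‖_{L^q}` for the sample `x` of size `n`. -/
def empiricalPsi {T : Type*} (p : T → ℝ → ℝ) (q : ℝ) (w : ℝ → ℝ) (x : ℕ → ℝ) (n : ℕ) (θ : T) : ℝ :=
  weightedLqNorm q w (empiricalEta (p θ) x n)

/-- The map `θ ↦ p_θ'(x) / p_θ(x)` is continuous for every `x > 0`. -/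
def ScoreContinuous {T : Type*} [TopologicalSpace T] (p : T → ℝ → ℝ) : Prop :=
  ∀ x : ℝ, 0 < x → Continuous (fun θ : T => scoreQuot (p θ) x)

/-- On each nonempty compact set of parameters, `θ ↦ p_θ'(x) / p_θ(x)` is Hölder
continuous with a constant `H(x)` such that `E[H(X) X] < ∞` for `X` with density `p_{θ₀}`. -/
def ScoreHoelder {T : Type*} [MetricSpace T] (p : T → ℝ → ℝ) (θ₀ : T) : Prop :=
  ∀ K : Set T, IsCompact K → K.Nonempty →
    ∃ α : ℝ, 0 < α ∧ ∃ H : ℝ → ℝ, Measurable H ∧ (∀ x, 0 < x → 0 ≤ H x) ∧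
      Integrable (fun x => H x * x) (halfLineLaw (p θ₀)) ∧
      ∀ x : ℝ, 0 < x → ∀ θ₁ ∈ K, ∀ θ₂ ∈ K,
        |scoreQuot (p θ₂) x - scoreQuot (p θ₁) x| ≤ H x * dist θ₂ θ₁ ^ α

end

/-! Write μ for the law of the sample and η(t, θ) for the expectation under μ of the kernel averaged
in η_n(t, θ). Integration by parts gives η(·, θ₀) = 0 on (0, ∞) (`populationEta_self`). Conversely
η(t, θ) = -E[u(X) min(X, t)], where u is the difference of the logarithmic derivatives at θ and θ₀.
If this vanishes for almost every t, its second differences in t, which test u against tent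
functions, force u = 0. The two densities are then proportional, hence equal, and identifiability
gives θ = θ₀. So ‖η(·, θ)‖ vanishes only at θ₀, and being continuous on compact sets it is bounded
below there away from θ₀ (`exists_pos_le_lpNorm_populationEta`).

The strong law, Fubini and dominated convergence give ‖η_n(·, θ) - η(·, θ)‖ → 0 almost surely for
each fixed θ. The Hölder condition upgrades this to uniform convergence on compact sets
(`ae_eventually_forall_lpNorm_empiricalEta_sub_lt`). Comparing an approximate minimiser with θ₀ then
keeps it near θ₀ whenever it lies in a given compact set; compactness of Θ, or tightness, removes
that proviso. -/

noncomputable section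

/-- The contribution of one observation `x` to the discrepancy at the point `t`, for the
logarithmic derivative `σ`. -/
def etaKernel (σ : ℝ → ℝ) (x t : ℝ) : ℝ :=
  -(σ x * min x t) - (Ici x).indicator (fun _ => (1 : ℝ)) t

/-- The expected discrepancy at the point `t` when the observations have law `μ`. -/
def populationEta (p : ℝ → ℝ) (μ : Measure ℝ) (t : ℝ) : ℝ := ∫ x, etaKernel (scoreQuot p) x t ∂μ

/-- Represents min(x, t) as ∫₀ᵗ 1{s < x} ds, which lets Fubini replace integration by parts. -/
lemma volume_real_Iio_inter_Ioc {x t : ℝ} (hx : 0 < x) (ht : 0 < t) :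
    (volume.restrict (Ioc 0 t)).real (Iio x) = min x t := by
  rw [measureReal_restrict_apply measurableSet_Iio]
  rcases le_or_gt x t with h | h
  · have : Iio x ∩ Ioc 0 t = Ioo 0 x := by
      ext y; simp only [mem_inter_iff, mem_Iio, mem_Ioc, mem_Ioo]
      constructor
      · rintro ⟨h1, h2, h3⟩; exact ⟨h2, h1⟩
      · rintro ⟨h1, h2⟩; exact ⟨h2, h1, h2.le.trans h⟩
    rw [this, min_eq_left h, Real.volume_real_Ioo_of_le hx.le, sub_zero]
  · have : Iio x ∩ Ioc 0 t = Ioc 0 t :=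
      inter_eq_right.mpr fun y hy => hy.2.trans_lt h
    rw [this, min_eq_right h.le, Real.volume_real_Ioc_of_le ht.le, sub_zero]

/-! ### Integration against a law with density on the half axis -/

section HalfLineLaw

variable {p : ℝ → ℝ}

lemma halfLineLaw_ae_pos (p : ℝ → ℝ) : ∀ᵐ x ∂(halfLineLaw p), 0 < x :=
  (withDensity_absolutelyContinuous _ _).ae_le (ae_restrict_mem measurableSet_Ioi)

lemma integral_halfLineLaw (hm : AEMeasurable p (volume.restrict (Ioi 0)))
    (hpos : ∀ x, 0 < x → 0 < p x) (f : ℝ → ℝ) :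
    ∫ x, f x ∂(halfLineLaw p) = ∫ x in Ioi (0 : ℝ), p x * f x := by
  rw [halfLineLaw, integral_withDensity_eq_integral_toReal_smul₀ hm.ennreal_ofReal
    (ae_of_all _ fun _ => ENNReal.ofReal_lt_top)]
  refine setIntegral_congr_fun measurableSet_Ioi fun x hx => ?_
  simp [ENNReal.toReal_ofReal (hpos x hx).le]

lemma integrable_halfLineLaw_iff (hm : AEMeasurable p (volume.restrict (Ioi 0)))
    (hpos : ∀ x, 0 < x → 0 < p x) (f : ℝ → ℝ) :
    Integrable f (halfLineLaw p) ↔ IntegrableOn (fun x => p x * f x) (Ioi (0 : ℝ)) := by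
  rw [halfLineLaw, integrable_withDensity_iff_integrable_smul₀' hm.ennreal_ofReal
    (ae_of_all _ fun _ => ENNReal.ofReal_lt_top)]
  refine integrableOn_congr_fun (fun x hx => ?_) measurableSet_Ioi
  simp [ENNReal.toReal_ofReal (hpos x hx).le]

/-- A positive density has the same null sets as Lebesgue measure on (0, ∞). This is applied both to
the true density and to the weight `w`. -/
lemma ae_halfLineLaw_iff (hm : AEMeasurable p (volume.restrict (Ioi 0)))
    (hpos : ∀ x, 0 < x → 0 < p x) {Q : ℝ → Prop} :
    (∀ᵐ x ∂(halfLineLaw p), Q x) ↔ ∀ᵐ x ∂(volume.restrict (Ioi (0 : ℝ))), Q x := by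
  refine ⟨fun h => ?_, fun h => (withDensity_absolutelyContinuous _ _).ae_le h⟩
  refine (withDensity_absolutelyContinuous' hm.ennreal_ofReal ?_).ae_le h
  filter_upwards [ae_restrict_mem measurableSet_Ioi] with x hx
  simpa using hpos x hx

instance : SFinite (halfLineLaw p) := by unfold halfLineLaw; infer_instance

end HalfLineLaw

/-! ### Population identity and identification of the density -/

namespace IsAdmissibleDensity

variable {p p₀ : ℝ → ℝ}

lemma continuousOn (hp : IsAdmissibleDensity p) : ContinuousOn p (Ioi 0) :=
  hp.contDiffOn.continuousOn

lemma aemeasurable (hp : IsAdmissibleDensity p) : AEMeasurable p (volume.restrict (Ioi 0)) :=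
  hp.continuousOn.aemeasurable measurableSet_Ioi

lemma hasDerivAt (hp : IsAdmissibleDensity p) {x : ℝ} (hx : 0 < x) :
    HasDerivAt p (deriv p x) x :=
  ((hp.contDiffOn.differentiableOn one_ne_zero).differentiableAt
    (Ioi_mem_nhds hx)).hasDerivAt

lemma continuousOn_deriv (hp : IsAdmissibleDensity p) : ContinuousOn (deriv p) (Ioi 0) :=
  hp.contDiffOn.continuousOn_deriv_of_isOpen isOpen_Ioi le_rfl

lemma continuousOn_scoreQuot (hp : IsAdmissibleDensity p) :
    ContinuousOn (scoreQuot p) (Ioi 0) :=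
  hp.continuousOn_deriv.div hp.continuousOn fun x hx => (hp.pos x hx).ne'

lemma mul_scoreQuot (hp : IsAdmissibleDensity p) {x : ℝ} (hx : 0 < x) :
    p x * scoreQuot p x = deriv p x := by
  rw [scoreQuot, mul_div_cancel₀ _ (hp.pos x hx).ne']

lemma integrable_iff (hp : IsAdmissibleDensity p) (f : ℝ → ℝ) :
    Integrable f (halfLineLaw p) ↔ IntegrableOn (fun x => p x * f x) (Ioi (0 : ℝ)) :=
  integrable_halfLineLaw_iff hp.aemeasurable hp.pos f

lemma integral_eq (hp : IsAdmissibleDensity p) (f : ℝ → ℝ) :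
    ∫ x, f x ∂(halfLineLaw p) = ∫ x in Ioi (0 : ℝ), p x * f x :=
  integral_halfLineLaw hp.aemeasurable hp.pos f

lemma isProbabilityMeasure (hp : IsAdmissibleDensity p) :
    IsProbabilityMeasure (halfLineLaw p) := by
  constructor
  rw [halfLineLaw, withDensity_apply _ MeasurableSet.univ, Measure.restrict_univ,
    ← ofReal_integral_eq_lintegral_ofReal hp.integrableOn, hp.integral_eq_one, ENNReal.ofReal_one]
  filter_upwards [ae_restrict_mem measurableSet_Ioi] with x hx using (hp.pos x hx).le

lemma aestronglyMeasurable_scoreQuot (hp : IsAdmissibleDensity p) (p₀ : ℝ → ℝ) :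
    AEStronglyMeasurable (scoreQuot p) (halfLineLaw p₀) :=
  (hp.continuousOn_scoreQuot.aestronglyMeasurable measurableSet_Ioi).mono_ac
    (withDensity_absolutelyContinuous _ _)

lemma integrable_scoreQuot_mul_id (hp : IsAdmissibleDensity p) :
    Integrable (fun x => scoreQuot p x * x) (halfLineLaw p) := by
  rw [hp.integrable_iff]
  have h : IntegrableOn (fun x => x * deriv p x) (Ioi 0) := by
    refine hp.integrableOn_mul_deriv.mono'
      ((continuousOn_id.mul hp.continuousOn_deriv).aestronglyMeasurable measurableSet_Ioi)
      (ae_of_all _ fun x => ?_)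
    simp
  refine (integrableOn_congr_fun (fun x hx => ?_) measurableSet_Ioi).mpr h
  rw [← mul_assoc, hp.mul_scoreQuot hx, mul_comm]

lemma integrableOn_deriv_Ioi (hp : IsAdmissibleDensity p) {s : ℝ} (hs : 0 < s) :
    IntegrableOn (deriv p) (Ioi s) := by
  have h := (hp.integrableOn_mul_deriv.mono_set (Ioi_subset_Ioi hs.le)).const_mul s⁻¹
  refine h.mono' ((hp.continuousOn_deriv.mono
    (Ioi_subset_Ioi hs.le)).aestronglyMeasurable measurableSet_Ioi) ?_
  filter_upwards [ae_restrict_mem measurableSet_Ioi] with x hx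
  have hx' : s < x := hx
  rw [abs_of_pos (hs.trans hx'), ← mul_assoc, Real.norm_eq_abs]
  refine le_mul_of_one_le_left (abs_nonneg _) ?_
  rw [inv_mul_eq_div, one_le_div hs]
  exact hx'.le

/-- Both `p` and its derivative are integrable near infinity, so `p` tends to zero there and only
the boundary term at `s` survives. -/
lemma integral_deriv_Ioi (hp : IsAdmissibleDensity p) {s : ℝ} (hs : 0 < s) :
    ∫ x in Ioi s, deriv p x = -p s := by
  have hd : ∀ x ∈ Ioi s, HasDerivAt p (deriv p x) x := fun x hx => hp.hasDerivAt (hs.trans hx)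
  have hi := hp.integrableOn_deriv_Ioi hs
  rw [integral_Ioi_of_hasDerivAt_of_tendsto (hp.hasDerivAt hs).continuousAt.continuousWithinAt hd
    hi (tendsto_zero_of_hasDerivAt_of_integrableOn_Ioi hd hi
      (hp.integrableOn.mono_set (Ioi_subset_Ioi hs.le)))]
  simp

/-- Fubini with min(x, t) = ∫₀ᵗ 1{s < x} ds reduces the claim to the tail integral of the
derivative. The integrable majorant is |x p'(x)|, so nothing is needed about `p` at 0. -/
lemma integral_deriv_mul_min (hp : IsAdmissibleDensity p) {t : ℝ} (ht : 0 < t) :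
    ∫ x in Ioi (0 : ℝ), deriv p x * min x t = -∫ s in Ioc 0 t, p s := by
  have hmin : ∀ x ∈ Ioi (0 : ℝ), ∀ c : ℝ,
      ∫ s in Ioc 0 t, (Iio x).indicator (fun _ => c) s = c * min x t := fun x hx c => by
    rw [integral_indicator_const _ measurableSet_Iio, volume_real_Iio_inter_Ioc hx ht,
      smul_eq_mul, mul_comm]
  have hmeas : Measurable fun z : ℝ × ℝ => (Iio z.1).indicator (fun _ => deriv p z.1) z.2 := by
    have : (fun z : ℝ × ℝ => (Iio z.1).indicator (fun _ => deriv p z.1) z.2)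
        = {z : ℝ × ℝ | z.2 < z.1}.indicator fun z => deriv p z.1 := by
      ext z; simp [indicator]
    rw [this]
    exact ((measurable_deriv p).comp measurable_fst).indicator
      (measurableSet_lt measurable_snd measurable_fst)
  have hint : Integrable (Function.uncurry fun x s => (Iio x).indicator (fun _ => deriv p x) s)
      ((volume.restrict (Ioi (0 : ℝ))).prod (volume.restrict (Ioc 0 t))) := by
    refine (integrable_prod_iff hmeas.aestronglyMeasurable).mpr ⟨ae_of_all _ fun x => ?_, ?_⟩
    · change Integrable ((Iio x).indicator fun _ => deriv p x) _
      exact (integrable_const _).indicator measurableSet_Iio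
    have : IntegrableOn (fun x => |deriv p x| * min x t) (Ioi 0) := by
      refine hp.integrableOn_mul_deriv.mono' ((measurable_deriv p).abs.mul
        (measurable_id.min measurable_const)).aestronglyMeasurable ?_
      filter_upwards [ae_restrict_mem measurableSet_Ioi] with x hx
      have hx' : 0 < x := hx
      rw [Real.norm_eq_abs, abs_mul, abs_abs, abs_of_pos (lt_min hx' ht), abs_of_pos hx', mul_comm]
      exact mul_le_mul_of_nonneg_right (min_le_left _ _) (abs_nonneg _)
    refine (integrableOn_congr_fun (fun x hx => ?_) measurableSet_Ioi).mpr this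
    simp only [norm_indicator_eq_indicator_norm]
    exact hmin x hx _
  calc ∫ x in Ioi (0 : ℝ), deriv p x * min x t
      = ∫ x in Ioi (0 : ℝ), ∫ s in Ioc 0 t, (Iio x).indicator (fun _ => deriv p x) s :=
        setIntegral_congr_fun measurableSet_Ioi fun x hx => (hmin x hx _).symm
    _ = ∫ s in Ioc 0 t, ∫ x in Ioi (0 : ℝ), (Iio x).indicator (fun _ => deriv p x) s :=
        integral_integral_swap hint
    _ = ∫ s in Ioc 0 t, -p s := by
        refine setIntegral_congr_fun measurableSet_Ioc fun s hs => ?_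
        have : ∀ x, (Iio x).indicator (fun _ => deriv p x) s = (Ioi s).indicator (deriv p) x :=
          fun x => by simp [indicator]
        simp only [this]
        rw [setIntegral_indicator measurableSet_Ioi,
          inter_eq_right.mpr (Ioi_subset_Ioi hs.1.le), hp.integral_deriv_Ioi hs.1]
    _ = -∫ s in Ioc 0 t, p s := integral_neg _

lemma integrable_scoreQuot_mul_min (hp : IsAdmissibleDensity p)
    (h : Integrable (fun x => scoreQuot p x * x) (halfLineLaw p₀)) {t : ℝ} (ht : 0 < t) :
    Integrable (fun x => scoreQuot p x * min x t) (halfLineLaw p₀) := by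
  refine h.norm.mono' ((hp.aestronglyMeasurable_scoreQuot p₀).mul
    (measurable_id.min measurable_const).aestronglyMeasurable) ?_
  filter_upwards [halfLineLaw_ae_pos p₀] with x hx
  rw [norm_mul, norm_mul]
  refine mul_le_mul_of_nonneg_left ?_ (norm_nonneg _)
  rw [Real.norm_of_nonneg hx.le, Real.norm_of_nonneg (lt_min hx ht).le]
  exact min_le_left _ _

lemma integrable_indicator_Ici (hp₀ : IsAdmissibleDensity p₀) (t : ℝ) :
    Integrable (fun x => (Ici x).indicator (fun _ => (1 : ℝ)) t) (halfLineLaw p₀) := by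
  have := hp₀.isProbabilityMeasure
  have h : ∀ x : ℝ, (Ici x).indicator (fun _ => (1 : ℝ)) t = (Iic t).indicator (fun _ => 1) x :=
    fun x => by simp [indicator]
  simp only [h]
  exact (integrable_const _).indicator measurableSet_Iic

lemma integrable_etaKernel (hp : IsAdmissibleDensity p) (hp₀ : IsAdmissibleDensity p₀)
    (h : Integrable (fun x => scoreQuot p x * x) (halfLineLaw p₀)) {t : ℝ} (ht : 0 < t) :
    Integrable (fun x => etaKernel (scoreQuot p) x t) (halfLineLaw p₀) :=
  (hp.integrable_scoreQuot_mul_min h ht).neg.sub (hp₀.integrable_indicator_Ici t)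

lemma populationEta_eq (hp : IsAdmissibleDensity p) (hp₀ : IsAdmissibleDensity p₀)
    (h : Integrable (fun x => scoreQuot p x * x) (halfLineLaw p₀)) {t : ℝ} (ht : 0 < t) :
    populationEta p (halfLineLaw p₀) t = -∫ x, scoreQuot p x * min x t ∂(halfLineLaw p₀)
      - ∫ x, (Ici x).indicator (fun _ => (1 : ℝ)) t ∂(halfLineLaw p₀) := by
  rw [← integral_neg]
  exact integral_sub (hp.integrable_scoreQuot_mul_min h ht).neg (hp₀.integrable_indicator_Ici t)

lemma populationEta_self (hp : IsAdmissibleDensity p) {t : ℝ} (ht : 0 < t) :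
    populationEta p (halfLineLaw p) t = 0 := by
  rw [hp.populationEta_eq hp hp.integrable_scoreQuot_mul_id ht, hp.integral_eq, hp.integral_eq]
  have h1 : ∫ x in Ioi (0 : ℝ), p x * (scoreQuot p x * min x t) = -∫ s in Ioc 0 t, p s := by
    rw [← hp.integral_deriv_mul_min ht]
    refine setIntegral_congr_fun measurableSet_Ioi fun x hx => ?_
    simp only [← mul_assoc, hp.mul_scoreQuot hx]
  have h2 : ∫ x in Ioi (0 : ℝ), p x * (Ici x).indicator (fun _ => (1 : ℝ)) t
      = ∫ s in Ioc 0 t, p s := by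
    have : ∀ x : ℝ, p x * (Ici x).indicator (fun _ => (1 : ℝ)) t = (Iic t).indicator p x :=
      fun x => by simp [indicator]
    simp only [this]
    rw [setIntegral_indicator measurableSet_Iic, Ioi_inter_Iic]
  rw [h1, h2]
  ring

/-- Formally, the second derivative in t of E[u(X) min(X, t)] is -u p₀. Second differences replace
it, so that no differentiation under the integral is required. -/
lemma scoreQuot_eqOn_of_populationEta_ae_eq_zero (hp : IsAdmissibleDensity p)
    (hp₀ : IsAdmissibleDensity p₀)
    (h : Integrable (fun x => scoreQuot p x * x) (halfLineLaw p₀))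
    (h0 : ∀ᵐ t ∂(volume.restrict (Ioi (0 : ℝ))), populationEta p (halfLineLaw p₀) t = 0) :
    EqOn (scoreQuot p) (scoreQuot p₀) (Ioi 0) := by
  set u : ℝ → ℝ := fun x => scoreQuot p x - scoreQuot p₀ x with hu
  have huc : ContinuousOn u (Ioi 0) := hp.continuousOn_scoreQuot.sub hp₀.continuousOn_scoreQuot
  have hi0 := hp₀.integrable_scoreQuot_mul_id
  have hux : Integrable (fun x => u x * x) (halfLineLaw p₀) :=
    (h.sub hi0).congr (ae_of_all _ fun x => by simp [hu, sub_mul])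
  have hui : ∀ t, 0 < t → Integrable (fun x => u x * min x t) (halfLineLaw p₀) := fun t ht =>
    ((hp.integrable_scoreQuot_mul_min h ht).sub (hp₀.integrable_scoreQuot_mul_min hi0 ht)).congr
      (ae_of_all _ fun x => by simp [hu, sub_mul])
  have hg : ∀ t, 0 < t → populationEta p (halfLineLaw p₀) t
      = -∫ x, u x * min x t ∂(halfLineLaw p₀) := fun t ht => by
    have e := hp₀.populationEta_self ht
    rw [hp₀.populationEta_eq hp₀ hi0 ht] at e
    rw [hp.populationEta_eq hp₀ h ht]
    simp only [hu, sub_mul]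
    rw [integral_sub (hp.integrable_scoreQuot_mul_min h ht)
      (hp₀.integrable_scoreQuot_mul_min hi0 ht)]
    linarith
  -- Continuity in t turns vanishing almost everywhere into vanishing at every t > 0, so that the
  -- three points b - ρ, b, b + ρ may be used.
  have hgc : ContinuousOn (fun t => ∫ x, u x * min x t ∂(halfLineLaw p₀)) (Ioi 0) := by
    refine continuousOn_of_dominated (bound := fun x => ‖u x * x‖)
      (fun t ht => (hui t ht).aestronglyMeasurable) (fun t ht => ?_) hux.norm
      (ae_of_all _ fun x => by fun_prop)
    filter_upwards [halfLineLaw_ae_pos p₀] with x hx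
    rw [norm_mul, norm_mul]
    refine mul_le_mul_of_nonneg_left ?_ (norm_nonneg _)
    rw [Real.norm_of_nonneg hx.le, Real.norm_of_nonneg (lt_min hx ht).le]
    exact min_le_left _ _
  have hg0 : EqOn (fun t => ∫ x, u x * min x t ∂(halfLineLaw p₀)) (fun _ => 0) (Ioi 0) := by
    refine Measure.eqOn_open_of_ae_eq (μ := volume) ?_ isOpen_Ioi hgc continuousOn_const
    filter_upwards [h0, ae_restrict_mem measurableSet_Ioi] with t ht ht'
    rw [hg t ht'] at ht
    simpa using ht
  intro b hb
  have hb' : (0 : ℝ) < b := hb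
  by_contra hne
  have hub : u b ≠ 0 := sub_ne_zero.mpr hne
  have hev : ∀ᶠ x in 𝓝 b, 0 < x ∧ 0 < u b * u x := by
    refine (lt_mem_nhds hb').and ?_
    have : ContinuousAt (fun x => u b * u x) b :=
      continuousAt_const.mul (huc.continuousAt (Ioi_mem_nhds hb'))
    exact this.eventually (lt_mem_nhds (mul_self_pos.mpr hub))
  obtain ⟨r, hr, hball⟩ := Metric.eventually_nhds_iff.mp hev
  -- Small enough that b - ρ > 0 and that u keeps the sign of u(b) on the support of the tent.
  set ρ := min (r / 2) (b / 2) with hρ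
  have hρ0 : 0 < ρ := lt_min (half_pos hr) (half_pos hb')
  have hρr : ρ < r := (min_le_left _ _).trans_lt (half_lt_self hr)
  have hρb : ρ < b := (min_le_right _ _).trans_lt (half_lt_self hb')
  -- The tent centred at b with height ρ and support [b - ρ, b + ρ], written as a second difference
  -- of x ↦ min(x, ·).
  set T : ℝ → ℝ := fun x => 2 * min x b - min x (b - ρ) - min x (b + ρ) with hT
  have hprod : ∀ x, 0 ≤ u b * u x * T x := fun x => by
    rcases le_or_gt x (b - ρ) with h1 | h1
    · have : T x = 0 := by
        simp only [hT]; rw [min_eq_left (by linarith), min_eq_left h1, min_eq_left (by linarith)]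
        ring
      simp [this]
    rcases le_or_gt (b + ρ) x with h2 | h2
    · have : T x = 0 := by
        simp only [hT]; rw [min_eq_right (by linarith), min_eq_right h1.le, min_eq_right h2]
        ring
      simp [this]
    have hx := hball (y := x) (by rw [Real.dist_eq, abs_lt]; constructor <;> linarith)
    refine mul_nonneg hx.2.le ?_
    simp only [hT]; rw [min_eq_right h1.le, min_eq_left h2.le]
    rcases min_cases x b with ⟨e, _⟩ | ⟨e, _⟩ <;> rw [e] <;> linarith
  have hdecomp : ∀ x, u b * u x * T x = u b * (2 * (u x * min x b) - u x * min x (b - ρ)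
      - u x * min x (b + ρ)) := fun x => by simp only [hT]; ring
  have i1 := (hui b hb').const_mul 2
  have i2 := hui (b - ρ) (by linarith)
  have i3 := hui (b + ρ) (by linarith)
  have hTi : Integrable (fun x => u b * u x * T x) (halfLineLaw p₀) := by
    simp only [hdecomp]
    exact ((i1.sub i2).sub i3).const_mul _
  have hT0 : ∫ x, u b * u x * T x ∂(halfLineLaw p₀) = 0 := by
    simp only [hdecomp]
    have e1 := hg0 (x := b) hb
    have e2 := hg0 (x := b - ρ) (show 0 < b - ρ by linarith)
    have e3 := hg0 (x := b + ρ) (show 0 < b + ρ by linarith)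
    simp only at e1 e2 e3
    have e4 : ∫ x, 2 * (u x * min x b) - u x * min x (b - ρ) ∂(halfLineLaw p₀) = 0 := by
      rw [integral_sub i1 i2, integral_const_mul, e1, e2]; simp
    have e5 : ∫ x, 2 * (u x * min x b) - u x * min x (b - ρ) - u x * min x (b + ρ)
        ∂(halfLineLaw p₀) = 0 := by
      refine (integral_sub (i1.sub i2) i3).trans ?_
      rw [e3, sub_zero]
      exact e4
    rw [integral_const_mul, e5, mul_zero]
  -- A nonnegative integrand with zero integral vanishes almost everywhere, hence everywhere on (0,
  -- ∞) by continuity; yet at b it equals u(b)²ρ > 0.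
  have hae := (integral_eq_zero_iff_of_nonneg hprod hTi).mp hT0
  have hae' := (ae_halfLineLaw_iff hp₀.aemeasurable hp₀.pos).mp hae
  have hEq := Measure.eqOn_open_of_ae_eq (μ := volume) hae' isOpen_Ioi
    ((continuousOn_const.mul huc).mul (by fun_prop)) continuousOn_const hb
  have hTb : T b = ρ := by
    simp only [hT]
    rw [min_self, min_eq_right (by linarith), min_eq_left (by linarith)]; ring
  simp only [hTb, Pi.zero_apply] at hEq
  exact (mul_pos (mul_self_pos.mpr hub) hρ0).ne' hEq

/-- The quotient p / p₀ has zero derivative, so it is constant; both densities have mass one, so the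
constant is 1. -/
lemma eqOn_of_scoreQuot_eqOn (hp : IsAdmissibleDensity p) (hp₀ : IsAdmissibleDensity p₀)
    (h : EqOn (scoreQuot p) (scoreQuot p₀) (Ioi 0)) : EqOn p p₀ (Ioi 0) := by
  have hd : ∀ x ∈ Ioi (0 : ℝ), HasDerivAt (fun x => p x / p₀ x) 0 x := fun x hx => by
    have h1 := (hp.hasDerivAt hx).div (hp₀.hasDerivAt hx) (hp₀.pos x hx).ne'
    have e : deriv p x * p₀ x - p x * deriv p₀ x = 0 := by
      rw [← hp.mul_scoreQuot hx, ← hp₀.mul_scoreQuot hx, h hx]; ring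
    rw [e, zero_div] at h1
    exact h1
  have hc : ∀ x ∈ Ioi (0 : ℝ), p x = p 1 / p₀ 1 * p₀ x := fun x hx => by
    have := isOpen_Ioi.is_const_of_deriv_eq_zero isPreconnected_Ioi
      (fun y hy => (hd y hy).differentiableAt.differentiableWithinAt)
      (fun y hy => (hd y hy).deriv) hx (mem_Ioi.mpr one_pos)
    rw [← this, div_mul_cancel₀ _ (hp₀.pos x hx).ne']
  have h1 : p 1 / p₀ 1 = 1 := by
    have := hp.integral_eq_one
    rwa [setIntegral_congr_fun measurableSet_Ioi hc, integral_const_mul, hp₀.integral_eq_one,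
      mul_one] at this
  intro x hx
  rw [hc x hx, h1, one_mul]

lemma eqOn_of_populationEta_ae_eq_zero (hp : IsAdmissibleDensity p)
    (hp₀ : IsAdmissibleDensity p₀)
    (h : Integrable (fun x => scoreQuot p x * x) (halfLineLaw p₀))
    (h0 : ∀ᵐ t ∂(volume.restrict (Ioi (0 : ℝ))), populationEta p (halfLineLaw p₀) t = 0) :
    EqOn p p₀ (Ioi 0) :=
  hp.eqOn_of_scoreQuot_eqOn hp₀ (hp.scoreQuot_eqOn_of_populationEta_ae_eq_zero hp₀ h h0)

end IsAdmissibleDensity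

/-! ### Norms on a finite measure space and bounds on the kernel -/

section LpNorm

variable {α : Type*} [MeasurableSpace α] {ν : Measure α} [IsFiniteMeasure ν]

lemma lpNorm_le_of_ae_bound {f : α → ℝ} {C : ℝ} (hC : 0 ≤ C) (hf : AEStronglyMeasurable f ν)
    (h : ∀ᵐ x ∂ν, |f x| ≤ C) (r : ENNReal) :
    lpNorm f r ν ≤ C * ν.real univ ^ r.toReal⁻¹ := by
  rw [← toReal_eLpNorm hf]
  have h1 := eLpNorm_le_of_ae_bound (p := r) (f := f) (C := C) h
  refine (ENNReal.toReal_mono ?_ h1).trans_eq ?_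
  · exact ENNReal.mul_ne_top (ENNReal.rpow_ne_top_of_nonneg (by positivity) (measure_ne_top _ _))
      ENNReal.ofReal_ne_top
  · rw [ENNReal.toReal_mul, ← ENNReal.toReal_rpow, ENNReal.toReal_ofReal hC, mul_comm,
      Measure.real]

lemma tendsto_lpNorm_zero_of_ae_bound {f : ℕ → α → ℝ} {C : ℝ} {r : ENNReal} (hr0 : r ≠ 0)
    (hr : r ≠ ⊤) (hf : ∀ n, AEStronglyMeasurable (f n) ν) (hb : ∀ n, ∀ᵐ x ∂ν, |f n x| ≤ C)
    (h : ∀ᵐ x ∂ν, Tendsto (fun n => f n x) atTop (𝓝 0)) :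
    Tendsto (fun n => lpNorm (f n) r ν) atTop (𝓝 0) := by
  have hrpos : 0 < r.toReal := ENNReal.toReal_pos hr0 hr
  have h1 : Tendsto (fun n => ∫ x, ‖f n x‖ ^ r.toReal ∂ν) atTop (𝓝 (∫ _, (0 : ℝ) ∂ν)) := by
    refine tendsto_integral_of_dominated_convergence (fun _ => C ^ r.toReal)
      (fun n => ((hf n).norm.aemeasurable.pow_const _).aestronglyMeasurable)
      (integrable_const _) (fun n => ?_) ?_
    · filter_upwards [hb n] with x hx
      rw [Real.norm_of_nonneg (by positivity)]
      exact Real.rpow_le_rpow (norm_nonneg _) hx hrpos.le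
    · filter_upwards [h] with x hx
      have := (hx.norm.rpow_const (p := r.toReal) (Or.inr hrpos.le))
      simpa [Real.zero_rpow hrpos.ne'] using this
  have h2 := h1.rpow_const (p := r.toReal⁻¹) (Or.inr (by positivity))
  rw [integral_zero, Real.zero_rpow (by positivity)] at h2
  exact h2.congr fun n => (lpNorm_eq_integral_norm_rpow_toReal hr0 hr (hf n)).symm

end LpNorm

/-- The measure w(t) dt is again of the form `halfLineLaw`, so the triangle inequality of L^q
becomes available. -/
lemma weightedLqNorm_eq_lpNorm {q : ℝ} (hq : 1 ≤ q) {w : ℝ → ℝ}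
    (hwm : AEMeasurable w (volume.restrict (Ioi 0))) (hwpos : ∀ t : ℝ, 0 < t → 0 < w t)
    {f : ℝ → ℝ} (hf : AEStronglyMeasurable f (halfLineLaw w)) :
    weightedLqNorm q w f = lpNorm f (ENNReal.ofReal q) (halfLineLaw w) := by
  have hq0 : 0 < q := by linarith
  rw [lpNorm_eq_integral_norm_rpow_toReal (by simpa using hq0) ENNReal.ofReal_ne_top hf,
    ENNReal.toReal_ofReal hq0.le, integral_halfLineLaw hwm hwpos, weightedLqNorm, one_div]
  simp only [Real.norm_eq_abs, mul_comm]

lemma empiricalEta_eq (p : ℝ → ℝ) (x : ℕ → ℝ) (n : ℕ) (t : ℝ) :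
    empiricalEta p x n t
      = (1 / (n : ℝ)) * ∑ j ∈ Finset.range n, etaKernel (scoreQuot p) (x j) t := by
  simp only [empiricalEta, etaKernel, Finset.sum_sub_distrib, Finset.sum_neg_distrib]
  ring

lemma measurable_etaKernel_uncurry {σ : ℝ → ℝ} (hσ : Measurable σ) :
    Measurable fun z : ℝ × ℝ => etaKernel σ z.1 z.2 := by
  have : (fun z : ℝ × ℝ => (Ici z.1).indicator (fun _ => (1 : ℝ)) z.2)
      = {z : ℝ × ℝ | z.1 ≤ z.2}.indicator fun _ => 1 := by
    ext z; simp [indicator]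
  refine ((hσ.comp measurable_fst).mul (measurable_fst.min measurable_snd)).neg.sub ?_
  rw [this]
  exact measurable_const.indicator (measurableSet_le measurable_fst measurable_snd)

lemma measurable_etaKernel (σ : ℝ → ℝ) (x : ℝ) : Measurable fun t => etaKernel σ x t :=
  ((measurable_const.min measurable_id).const_mul _).neg.sub
    (measurable_const.indicator measurableSet_Ici)

lemma measurable_empiricalEta (p : ℝ → ℝ) (x : ℕ → ℝ) (n : ℕ) :
    Measurable (empiricalEta p x n) := by
  have : empiricalEta p x n = fun t => (1 / (n : ℝ)) *
      ∑ j ∈ Finset.range n, etaKernel (scoreQuot p) (x j) t := funext (empiricalEta_eq p x n)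
  rw [this]
  exact (Finset.measurable_sum _ fun j _ => measurable_etaKernel _ _).const_mul _

lemma abs_etaKernel_le (σ : ℝ → ℝ) {x t : ℝ} (hx : 0 < x) (ht : 0 < t) :
    |etaKernel σ x t| ≤ |σ x * x| + 1 := by
  refine (abs_sub _ _).trans (add_le_add ?_ ?_)
  · rw [abs_neg, abs_mul, abs_mul]
    refine mul_le_mul_of_nonneg_left ?_ (abs_nonneg _)
    rw [abs_of_pos hx, abs_of_pos (lt_min hx ht)]
    exact min_le_left _ _
  · by_cases h : t ∈ Ici x <;> simp [h]

/-- The indicator does not depend on the parameter and cancels; the remaining bound is uniform in t.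
-/
lemma abs_etaKernel_sub_le (σ τ : ℝ → ℝ) {x t : ℝ} (hx : 0 < x) (ht : 0 < t) :
    |etaKernel σ x t - etaKernel τ x t| ≤ |σ x - τ x| * x := by
  have : etaKernel σ x t - etaKernel τ x t = -((σ x - τ x) * min x t) := by
    simp only [etaKernel]; ring
  rw [this, abs_neg, abs_mul, abs_of_pos (lt_min hx ht)]
  exact mul_le_mul_of_nonneg_left (min_le_left _ _) (abs_nonneg _)

/-! ### Strong law for sample averages -/

section Average

lemma abs_average_le {n : ℕ} {f g : ℕ → ℝ} (h : ∀ j, |f j| ≤ g j) :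
    |(1 / (n : ℝ)) * ∑ j ∈ Finset.range n, f j| ≤ (1 / (n : ℝ)) * ∑ j ∈ Finset.range n, g j := by
  rw [abs_mul, abs_of_nonneg (by positivity)]
  refine mul_le_mul_of_nonneg_left ?_ (by positivity)
  exact (Finset.abs_sum_le_sum_abs _ _).trans (Finset.sum_le_sum fun j _ => h j)

variable {Ω : Type*} [MeasurableSpace Ω] {P : Measure Ω} {X : ℕ → Ω → ℝ} {μ : Measure ℝ}

lemma ae_forall_sample (hXmeas : ∀ j, Measurable (X j)) (hXlaw : ∀ j, P.map (X j) = μ)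
    {Q : ℝ → Prop} (h : ∀ᵐ x ∂μ, Q x) : ∀ᵐ ω ∂P, ∀ j, Q (X j ω) :=
  ae_all_iff.mpr fun j => ae_of_ae_map (hXmeas j).aemeasurable (by rwa [hXlaw j])

lemma ae_tendsto_average (hXmeas : ∀ j, Measurable (X j))
    (hXindep : iIndepFun X P) (hXlaw : ∀ j, P.map (X j) = μ) {f : ℝ → ℝ} (hf : Integrable f μ) :
    ∀ᵐ ω ∂P, Tendsto (fun n : ℕ => (1 / (n : ℝ)) * ∑ j ∈ Finset.range n, f (X j ω)) atTop
      (𝓝 (∫ x, f x ∂μ)) := by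
  have hfm : ∀ j, AEMeasurable f (P.map (X j)) := fun j => by
    rw [hXlaw j]; exact hf.aestronglyMeasurable.aemeasurable
  have h := strong_law_ae_real (μ := P) (fun j => f ∘ X j)
    ((integrable_map_measure (by rw [hXlaw 0]; exact hf.aestronglyMeasurable)
      (hXmeas 0).aemeasurable).mp (by rwa [hXlaw 0]))
    (fun i j hij => (hXindep.indepFun hij).comp₀ (hXmeas i).aemeasurable (hXmeas j).aemeasurable
      (hfm i) (hfm j))
    (fun i => IdentDistrib.comp_of_aemeasurable
      ⟨(hXmeas i).aemeasurable, (hXmeas 0).aemeasurable, by rw [hXlaw i, hXlaw 0]⟩ (hfm i))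
  have e : ∫ ω, (f ∘ X 0) ω ∂P = ∫ x, f x ∂μ := by
    rw [← hXlaw 0, integral_map (hXmeas 0).aemeasurable (hfm 0).aestronglyMeasurable]; rfl
  rw [e] at h
  filter_upwards [h] with ω hω
  refine hω.congr fun n => ?_
  rw [one_div, inv_mul_eq_div]; rfl

end Average

/-! ### Convergence of the empirical discrepancy at a fixed parameter -/

section Empirical

variable {Ω : Type*} [MeasurableSpace Ω] {P : Measure Ω} [IsProbabilityMeasure P]
  {X : ℕ → Ω → ℝ} {p p₀ : ℝ → ℝ}

lemma aestronglyMeasurable_populationEta (hp : IsAdmissibleDensity p) (p₀ : ℝ → ℝ)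
    (ν : Measure ℝ) :
    AEStronglyMeasurable (populationEta p (halfLineLaw p₀)) ν := by
  have hσ := hp.aestronglyMeasurable_scoreQuot p₀
  have e : populationEta p (halfLineLaw p₀)
      = fun t => ∫ x, etaKernel (hσ.mk _) x t ∂(halfLineLaw p₀) := by
    ext t
    refine integral_congr_ae ?_
    filter_upwards [hσ.ae_eq_mk] with x hx
    simp only [etaKernel, hx]
  rw [e]
  exact (StronglyMeasurable.integral_prod_right (f := fun t x => etaKernel (hσ.mk _) x t)
    ((measurable_etaKernel_uncurry hσ.stronglyMeasurable_mk.measurable).comp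
      measurable_swap).stronglyMeasurable).aestronglyMeasurable

/-- The null set in the strong law depends on t; Fubini exchanges the two "almost every"
quantifiers. This needs joint measurability, hence the measurable modification of the logarithmic
derivative. -/
lemma ae_ae_tendsto_empiricalEta (hp : IsAdmissibleDensity p) (hp₀ : IsAdmissibleDensity p₀)
    (h : Integrable (fun x => scoreQuot p x * x) (halfLineLaw p₀))
    (hXmeas : ∀ j, Measurable (X j)) (hXindep : iIndepFun X P)
    (hXlaw : ∀ j, P.map (X j) = halfLineLaw p₀) (w : ℝ → ℝ) :
    ∀ᵐ ω ∂P, ∀ᵐ t ∂(halfLineLaw w), Tendsto (fun n => empiricalEta p (fun j => X j ω) n t) atTop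
      (𝓝 (populationEta p (halfLineLaw p₀) t)) := by
  have hσ := hp.aestronglyMeasurable_scoreQuot p₀
  set σ := hσ.mk (scoreQuot p) with hσdef
  have hσm : Measurable σ := hσ.stronglyMeasurable_mk.measurable
  have hk := measurable_etaKernel_uncurry hσm
  have hset : MeasurableSet {z : Ω × ℝ | Tendsto (fun n : ℕ =>
      (1 / (n : ℝ)) * ∑ j ∈ Finset.range n, etaKernel σ (X j z.1) z.2) atTop
      (𝓝 (∫ x, etaKernel σ x z.2 ∂(halfLineLaw p₀)))} := by
    refine measurableSet_tendsto_fun (fun n => ?_) ?_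
    · exact (Finset.measurable_sum _ fun j _ => hk.comp
        (((hXmeas j).comp measurable_fst).prodMk measurable_snd)).const_mul _
    · exact (StronglyMeasurable.integral_prod_right (f := fun t x => etaKernel σ x t)
        (hk.comp measurable_swap).stronglyMeasurable).measurable.comp measurable_snd
  have hcomm := (Measure.ae_ae_comm (μ := P) (ν := halfLineLaw w)
    (p := fun ω t => Tendsto (fun n : ℕ =>
      (1 / (n : ℝ)) * ∑ j ∈ Finset.range n, etaKernel σ (X j ω) t) atTop
      (𝓝 (∫ x, etaKernel σ x t ∂(halfLineLaw p₀)))) hset).mpr (by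
    filter_upwards [halfLineLaw_ae_pos w] with t ht
    refine ae_tendsto_average hXmeas hXindep hXlaw (f := fun x => etaKernel σ x t)
      ((hp.integrable_etaKernel hp₀ h ht).congr ?_)
    filter_upwards [hσ.ae_eq_mk] with x hx
    simp only [etaKernel, hx, hσdef])
  filter_upwards [hcomm, ae_forall_sample hXmeas hXlaw hσ.ae_eq_mk] with ω hω hX
  filter_upwards [hω] with t ht
  have e1 : populationEta p (halfLineLaw p₀) t = ∫ x, etaKernel σ x t ∂(halfLineLaw p₀) := by
    refine integral_congr_ae ?_
    filter_upwards [hσ.ae_eq_mk] with x hx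
    simp only [etaKernel, hx, hσdef]
  rw [e1]
  refine ht.congr fun n => ?_
  simp only [empiricalEta_eq, etaKernel, hX, hσdef]

lemma abs_populationEta_le (hp : IsAdmissibleDensity p) (hp₀ : IsAdmissibleDensity p₀)
    (h : Integrable (fun x => scoreQuot p x * x) (halfLineLaw p₀)) {t : ℝ} (ht : 0 < t) :
    |populationEta p (halfLineLaw p₀) t|
      ≤ (∫ x, |scoreQuot p x * x| ∂(halfLineLaw p₀)) + 1 := by
  have := hp₀.isProbabilityMeasure
  have e : ∫ x, (|scoreQuot p x * x| + 1) ∂(halfLineLaw p₀)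
      = (∫ x, |scoreQuot p x * x| ∂(halfLineLaw p₀)) + 1 := by
    rw [integral_add h.abs (integrable_const _)]; simp
  rw [← e]
  refine abs_integral_le_integral_abs.trans (integral_mono_ae
    (hp.integrable_etaKernel hp₀ h ht).abs (h.abs.add (integrable_const _)) ?_)
  filter_upwards [halfLineLaw_ae_pos p₀] with x hx using abs_etaKernel_le _ hx ht

lemma abs_empiricalEta_le (p : ℝ → ℝ) {x : ℕ → ℝ} (hx : ∀ j, 0 < x j) (n : ℕ) {t : ℝ}
    (ht : 0 < t) :
    |empiricalEta p x n t|
      ≤ (1 / (n : ℝ)) * ∑ j ∈ Finset.range n, |scoreQuot p (x j) * x j| + 1 := by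
  rw [empiricalEta_eq]
  refine (abs_average_le fun j => abs_etaKernel_le _ (hx j) ht).trans ?_
  rw [Finset.sum_add_distrib, mul_add]
  gcongr
  -- The average of the constant 1 is 1, except for n = 0, where it is 0.
  rcases eq_or_ne (n : ℝ) 0 with h0 | h0 <;> simp [h0]

lemma memLp_populationEta (hp : IsAdmissibleDensity p) (hp₀ : IsAdmissibleDensity p₀)
    (h : Integrable (fun x => scoreQuot p x * x) (halfLineLaw p₀)) {w : ℝ → ℝ}
    [IsFiniteMeasure (halfLineLaw w)] (r : ENNReal) :
    MemLp (populationEta p (halfLineLaw p₀)) r (halfLineLaw w) := by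
  refine MemLp.of_bound (aestronglyMeasurable_populationEta hp p₀ _)
    ((∫ x, |scoreQuot p x * x| ∂(halfLineLaw p₀)) + 1) ?_
  filter_upwards [halfLineLaw_ae_pos w] with t ht using abs_populationEta_le hp hp₀ h ht

lemma memLp_empiricalEta (p : ℝ → ℝ) {x : ℕ → ℝ} (hx : ∀ j, 0 < x j) (n : ℕ) {w : ℝ → ℝ}
    [IsFiniteMeasure (halfLineLaw w)] (r : ENNReal) :
    MemLp (empiricalEta p x n) r (halfLineLaw w) := by
  refine MemLp.of_bound (measurable_empiricalEta p x n).aestronglyMeasurable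
    ((1 / (n : ℝ)) * ∑ j ∈ Finset.range n, |scoreQuot p (x j) * x j| + 1) ?_
  filter_upwards [halfLineLaw_ae_pos w] with t ht using abs_empiricalEta_le p hx n ht

lemma ae_tendsto_lpNorm_empiricalEta_sub (hp : IsAdmissibleDensity p)
    (hp₀ : IsAdmissibleDensity p₀)
    (h : Integrable (fun x => scoreQuot p x * x) (halfLineLaw p₀))
    (hXmeas : ∀ j, Measurable (X j)) (hXindep : iIndepFun X P)
    (hXlaw : ∀ j, P.map (X j) = halfLineLaw p₀) {w : ℝ → ℝ} [IsFiniteMeasure (halfLineLaw w)]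
    {r : ENNReal} (hr0 : r ≠ 0) (hr : r ≠ ⊤) :
    ∀ᵐ ω ∂P, Tendsto (fun n => lpNorm (empiricalEta p (fun j => X j ω) n
      - populationEta p (halfLineLaw p₀)) r (halfLineLaw w)) atTop (𝓝 0) := by
  filter_upwards [ae_ae_tendsto_empiricalEta hp hp₀ h hXmeas hXindep hXlaw w,
    ae_tendsto_average hXmeas hXindep hXlaw h.abs,
    ae_forall_sample hXmeas hXlaw (halfLineLaw_ae_pos p₀)] with ω hω hav hpos
  -- Convergent averages are bounded, which supplies a dominating constant independent of n and t.
  obtain ⟨C, hC⟩ := hav.bddAbove_range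
  refine tendsto_lpNorm_zero_of_ae_bound
    (C := C + 1 + ((∫ x, |scoreQuot p x * x| ∂(halfLineLaw p₀)) + 1)) hr0 hr
    (fun n => (measurable_empiricalEta _ _ _).aestronglyMeasurable.sub
      (aestronglyMeasurable_populationEta hp p₀ _)) (fun n => ?_) ?_
  · filter_upwards [halfLineLaw_ae_pos w] with t ht
    refine (abs_sub _ _).trans (add_le_add ((abs_empiricalEta_le p hpos n ht).trans ?_)
      (abs_populationEta_le hp hp₀ h ht))
    gcongr
    exact hC ⟨n, rfl⟩
  · filter_upwards [hω] with t ht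
    simpa using ht.sub_const (populationEta p (halfLineLaw p₀) t)

end Empirical

/-- A sequence of functions that is asymptotically equi-Hölder on a compact set and tends to `0`
pointwise on a dense subset tends to `0` uniformly. -/
lemma eventually_forall_lt_of_holder {T : Type*} [MetricSpace T] {K D : Set T} (hK : IsCompact K)
    (hDK : D ⊆ K) (hKD : K ⊆ closure D) {G : ℕ → T → ℝ} {C α : ℝ} (hα : 0 < α)
    (hG : ∀ n, ∀ θ ∈ K, ∀ θ' ∈ K, G n θ ≤ G n θ' + C * dist θ θ' ^ α)
    (hD : ∀ θ ∈ D, Tendsto (fun n => G n θ) atTop (𝓝 0)) {ε : ℝ} (hε : 0 < ε) :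
    ∀ᶠ n in atTop, ∀ θ ∈ K, G n θ < ε := by
  have hlim : Tendsto (fun s : ℝ => C * s ^ α) (𝓝 0) (𝓝 0) := by
    have := ((Real.continuousAt_rpow_const 0 α (Or.inr hα.le)).tendsto).const_mul C
    simpa [Real.zero_rpow hα.ne'] using this
  obtain ⟨δ, hδ, hδε⟩ := Metric.eventually_nhds_iff.mp (hlim.eventually (gt_mem_nhds (half_pos hε)))
  obtain ⟨F, hF⟩ := hK.elim_finite_subcover (fun θ : D => Metric.ball (θ : T) δ)
    (fun _ => Metric.isOpen_ball) fun θ hθ => by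
      obtain ⟨θ', hθ', h⟩ := Metric.mem_closure_iff.mp (hKD hθ) δ hδ
      exact mem_iUnion.mpr ⟨⟨θ', hθ'⟩, h⟩
  have hev : ∀ᶠ n in atTop, ∀ θ ∈ F, G n (θ : T) < ε / 2 :=
    (Finset.eventually_all F).mpr fun θ _ => (hD θ θ.2).eventually (gt_mem_nhds (half_pos hε))
  filter_upwards [hev] with n hn θ hθ
  obtain ⟨θ', hθ'F, hd⟩ := mem_iUnion₂.mp (hF hθ)
  have h1 := hG n θ hθ θ' (hDK θ'.2)
  have h2 := hδε (y := dist θ θ') (by rwa [Real.dist_0_eq_abs, abs_of_nonneg dist_nonneg])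
  have h3 := hn θ' hθ'F
  linarith

lemma continuousOn_of_holder {T : Type*} [MetricSpace T] {K : Set T} {Ψ : T → ℝ} {C α : ℝ}
    (hα : 0 < α) (h : ∀ θ ∈ K, ∀ θ' ∈ K, Ψ θ ≤ Ψ θ' + C * dist θ θ' ^ α) : ContinuousOn Ψ K := by
  intro θ hθ
  have hlim : Tendsto (fun s => C * dist s θ ^ α) (𝓝[K] θ) (𝓝 0) := by
    have : Continuous fun s => C * dist s θ ^ α :=
      ((continuous_id.dist continuous_const).rpow_const fun _ => Or.inr hα.le).const_mul C
    have h := (this.tendsto θ).mono_left (nhdsWithin_le_nhds (s := K))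
    simpa [Real.zero_rpow hα.ne'] using h
  refine tendsto_iff_dist_tendsto_zero.mpr (squeeze_zero' (Eventually.of_forall fun _ =>
    dist_nonneg) ?_ hlim)
  filter_upwards [self_mem_nhdsWithin] with s hs
  -- The one-sided hypothesis, used in both orders, gives the two-sided bound.
  have h1 := h s hs θ hθ
  have h2 := h θ hθ s hs
  rw [dist_comm] at h2
  rw [Real.dist_eq, abs_le]
  constructor <;> linarith

/-! ### Separation, uniform convergence and approximate minimisers -/

section Consistency

variable {Ω : Type*} [MeasurableSpace Ω] {P : Measure Ω} [IsProbabilityMeasure P]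
  {T : Type*} [MetricSpace T] {p : T → ℝ → ℝ} {θ₀ : T} {X : ℕ → Ω → ℝ} {w : ℝ → ℝ}

/-- The Hölder condition on the compact set {θ, θ₀} transfers integrability from θ₀, where it is
part of admissibility, to θ. -/
lemma ScoreHoelder.integrable_scoreQuot_mul_id (hR3 : ScoreHoelder p θ₀)
    (hp : ∀ θ, IsAdmissibleDensity (p θ)) (θ : T) :
    Integrable (fun x => scoreQuot (p θ) x * x) (halfLineLaw (p θ₀)) := by
  obtain ⟨α, -, H, -, -, hHi, hH⟩ := hR3 {θ, θ₀} (Set.toFinite _).isCompact ⟨θ, by simp⟩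
  have hi := (hp θ₀).integrable_scoreQuot_mul_id
  refine (hi.abs.add (hHi.mul_const (dist θ θ₀ ^ α))).mono'
    (((hp θ).aestronglyMeasurable_scoreQuot _).mul measurable_id.aestronglyMeasurable) ?_
  filter_upwards [halfLineLaw_ae_pos (p θ₀)] with x hx
  have h1 := hH x hx θ₀ (by simp) θ (by simp)
  have h2 := mul_le_mul_of_nonneg_right h1 hx.le
  have h3 : scoreQuot (p θ) x * x
      = scoreQuot (p θ₀) x * x + (scoreQuot (p θ) x - scoreQuot (p θ₀) x) * x := by ring
  rw [Real.norm_eq_abs, h3]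
  refine (abs_add_le _ _).trans (add_le_add le_rfl ?_)
  rw [abs_mul, abs_of_pos hx]
  exact h2.trans_eq (by ring)

lemma abs_populationEta_sub_le {p₁ p₂ p₀ H : ℝ → ℝ} (hp₁ : IsAdmissibleDensity p₁)
    (hp₂ : IsAdmissibleDensity p₂) (hp₀ : IsAdmissibleDensity p₀)
    (h₁ : Integrable (fun x => scoreQuot p₁ x * x) (halfLineLaw p₀))
    (h₂ : Integrable (fun x => scoreQuot p₂ x * x) (halfLineLaw p₀))
    (hHi : Integrable (fun x => H x * x) (halfLineLaw p₀)) {D : ℝ}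
    (hH : ∀ x, 0 < x → |scoreQuot p₁ x - scoreQuot p₂ x| ≤ H x * D) {t : ℝ} (ht : 0 < t) :
    |populationEta p₁ (halfLineLaw p₀) t - populationEta p₂ (halfLineLaw p₀) t|
      ≤ (∫ x, H x * x ∂(halfLineLaw p₀)) * D := by
  have i₁ := hp₁.integrable_etaKernel hp₀ h₁ ht
  have i₂ := hp₂.integrable_etaKernel hp₀ h₂ ht
  rw [populationEta, populationEta, ← integral_sub i₁ i₂, ← integral_mul_const]
  refine abs_integral_le_integral_abs.trans
    (integral_mono_ae (i₁.sub i₂).abs (hHi.mul_const D) ?_)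
  filter_upwards [halfLineLaw_ae_pos p₀] with x hx
  exact (abs_etaKernel_sub_le _ _ hx ht).trans
    ((mul_le_mul_of_nonneg_right (hH x hx) hx.le).trans_eq (by ring))

lemma abs_empiricalEta_sub_le {p₁ p₂ H : ℝ → ℝ} {x : ℕ → ℝ} (hx : ∀ j, 0 < x j) (n : ℕ) {D : ℝ}
    (hH : ∀ x, 0 < x → |scoreQuot p₁ x - scoreQuot p₂ x| ≤ H x * D) {t : ℝ} (ht : 0 < t) :
    |empiricalEta p₁ x n t - empiricalEta p₂ x n t|
      ≤ ((1 / (n : ℝ)) * ∑ j ∈ Finset.range n, H (x j) * x j) * D := by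
  rw [empiricalEta_eq, empiricalEta_eq, ← mul_sub, ← Finset.sum_sub_distrib, mul_assoc,
    Finset.sum_mul]
  exact abs_average_le fun j => (abs_etaKernel_sub_le _ _ (hx j) ht).trans
    ((mul_le_mul_of_nonneg_right (hH _ (hx j)) (hx j).le).trans_eq (by ring))

/-- The norm is Hölder in θ, so it attains its minimum over the part of K at distance at least ρ
from θ₀; a zero minimum would contradict identifiability. -/
lemma exists_pos_le_lpNorm_populationEta (hp : ∀ θ, IsAdmissibleDensity (p θ))
    (hident : ∀ θ, (∀ x : ℝ, 0 < x → p θ x = p θ₀ x) → θ = θ₀) (hR3 : ScoreHoelder p θ₀)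
    (hwm : AEMeasurable w (volume.restrict (Ioi 0))) (hwpos : ∀ t : ℝ, 0 < t → 0 < w t)
    [IsFiniteMeasure (halfLineLaw w)] {r : ENNReal} (hr : 1 ≤ r) {K : Set T} (hK : IsCompact K)
    {ρ : ℝ} (hρ : 0 < ρ) :
    ∃ c, 0 < c ∧ ∀ θ ∈ K, ρ ≤ dist θ θ₀ →
      c ≤ lpNorm (populationEta (p θ) (halfLineLaw (p θ₀))) r (halfLineLaw w) := by
  have hi := hR3.integrable_scoreQuot_mul_id hp
  have hS : IsCompact (K ∩ {θ | ρ ≤ dist θ θ₀}) :=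
    hK.inter_right (isClosed_le continuous_const (continuous_id.dist continuous_const))
  rcases (K ∩ {θ | ρ ≤ dist θ θ₀}).eq_empty_or_nonempty with hE | hne
  · refine ⟨1, one_pos, fun θ hθ hd => ?_⟩
    have : θ ∈ K ∩ {θ | ρ ≤ dist θ θ₀} := ⟨hθ, hd⟩
    simp [hE] at this
  obtain ⟨α, hα, H, -, hH0, hHi, hH⟩ := hR3 _ hS hne
  have hI0 : 0 ≤ ∫ x, H x * x ∂(halfLineLaw (p θ₀)) := by
    refine integral_nonneg_of_ae ?_
    filter_upwards [halfLineLaw_ae_pos (p θ₀)] with x hx using mul_nonneg (hH0 x hx) hx.le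
  have hcont := continuousOn_of_holder (K := K ∩ {θ | ρ ≤ dist θ θ₀})
    (Ψ := fun θ => lpNorm (populationEta (p θ) (halfLineLaw (p θ₀))) r (halfLineLaw w))
    (C := (∫ x, H x * x ∂(halfLineLaw (p θ₀))) * (halfLineLaw w).real univ ^ r.toReal⁻¹) hα
    (fun θ hθ θ' hθ' => by
      refine (lpNorm_le_lpNorm_add_lpNorm_sub (memLp_populationEta (hp θ') (hp θ₀) (hi θ') r)
        hr).trans (add_le_add le_rfl ?_)
      rw [lpNorm_sub_comm]
      refine (lpNorm_le_of_ae_bound (by positivity)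
        ((aestronglyMeasurable_populationEta (hp θ) _ _).sub
          (aestronglyMeasurable_populationEta (hp θ') _ _)) ?_ r).trans_eq (mul_right_comm _ _ _)
      filter_upwards [halfLineLaw_ae_pos w] with t ht
      exact abs_populationEta_sub_le (hp θ) (hp θ') (hp θ₀) (hi θ) (hi θ') hHi
        (fun x hx => hH x hx θ' hθ' θ hθ) ht)
  obtain ⟨θm, hθm, hmin⟩ := hS.exists_isMinOn hne hcont
  refine ⟨_, lt_of_le_of_ne lpNorm_nonneg fun h0 => ?_, fun θ hθ hd => hmin ⟨hθ, hd⟩⟩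
  have hae := (lpNorm_eq_zero (memLp_populationEta (hp θm) (hp θ₀) (hi θm) r)
    (one_pos.trans_le hr).ne').mp h0.symm
  have heq := (hp θm).eqOn_of_populationEta_ae_eq_zero (hp θ₀) (hi θm)
    ((ae_halfLineLaw_iff hwm hwpos).mp hae)
  have : θm = θ₀ := hident θm fun x hx => heq hx
  have hd : ρ ≤ dist θm θ₀ := hθm.2
  rw [this, dist_self] at hd
  linarith

/-- A countable dense subset of K needs only one null set. The Hölder constants in θ are bounded in
n because the averages of H(Xⱼ)Xⱼ converge. -/
lemma ae_eventually_forall_lpNorm_empiricalEta_sub_lt (hp : ∀ θ, IsAdmissibleDensity (p θ))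
    (hR3 : ScoreHoelder p θ₀) (hXmeas : ∀ j, Measurable (X j)) (hXindep : iIndepFun X P)
    (hXlaw : ∀ j, P.map (X j) = halfLineLaw (p θ₀))
    [IsFiniteMeasure (halfLineLaw w)] {r : ENNReal} (hr : 1 ≤ r) (hr' : r ≠ ⊤) {K : Set T}
    (hK : IsCompact K) :
    ∀ᵐ ω ∂P, ∀ ε > 0, ∀ᶠ n in atTop, ∀ θ ∈ K,
      lpNorm (empiricalEta (p θ) (fun j => X j ω) n - populationEta (p θ) (halfLineLaw (p θ₀))) r
        (halfLineLaw w) < ε := by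
  rcases K.eq_empty_or_nonempty with rfl | hne
  · simp
  have hi := hR3.integrable_scoreQuot_mul_id hp
  obtain ⟨D, hDK, hDc, hKD⟩ := hK.isSeparable.exists_countable_dense_subset
  obtain ⟨α, hα, H, -, hH0, hHi, hH⟩ := hR3 K hK hne
  have hI0 : 0 ≤ ∫ x, H x * x ∂(halfLineLaw (p θ₀)) := by
    refine integral_nonneg_of_ae ?_
    filter_upwards [halfLineLaw_ae_pos (p θ₀)] with x hx using mul_nonneg (hH0 x hx) hx.le
  filter_upwards [(ae_ball_iff hDc).mpr fun θ _ => ae_tendsto_lpNorm_empiricalEta_sub (hp θ)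
    (hp θ₀) (hi θ) hXmeas hXindep hXlaw (w := w) (one_pos.trans_le hr).ne' hr',
    ae_tendsto_average hXmeas hXindep hXlaw hHi,
    ae_forall_sample hXmeas hXlaw (halfLineLaw_ae_pos (p θ₀))] with ω hω hav hpos ε hε
  obtain ⟨C, hC⟩ := hav.bddAbove_range
  -- The average for n = 0 equals 0, so any upper bound is nonnegative.
  have hC0 : 0 ≤ C := by simpa using hC ⟨0, rfl⟩
  refine eventually_forall_lt_of_holder (C := (C + ∫ x, H x * x ∂(halfLineLaw (p θ₀)))
    * (halfLineLaw w).real univ ^ r.toReal⁻¹) hK hDK hKD hα (fun n θ hθ θ' hθ' => ?_) hω hε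
  have hm : ∀ θ, MemLp (empiricalEta (p θ) (fun j => X j ω) n
      - populationEta (p θ) (halfLineLaw (p θ₀))) r (halfLineLaw w) := fun θ =>
    (memLp_empiricalEta (p θ) hpos n r).sub (memLp_populationEta (hp θ) (hp θ₀) (hi θ) r)
  refine (lpNorm_le_lpNorm_add_lpNorm_sub (hm θ') hr).trans (add_le_add le_rfl ?_)
  rw [lpNorm_sub_comm]
  refine (lpNorm_le_of_ae_bound (by positivity) ((hm θ).sub (hm θ')).aestronglyMeasurable ?_
    r).trans_eq (mul_right_comm _ _ _)
  filter_upwards [halfLineLaw_ae_pos w] with t ht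
  have hHx := fun x (hx : 0 < x) => hH x hx θ' hθ' θ hθ
  have h1 := abs_empiricalEta_sub_le hpos n hHx ht
  have h2 := abs_populationEta_sub_le (hp θ) (hp θ') (hp θ₀) (hi θ) (hi θ') hHi hHx ht
  have h3 : ((1 / (n : ℝ)) * ∑ j ∈ Finset.range n, H (X j ω) * X j ω) * dist θ θ' ^ α
      ≤ C * dist θ θ' ^ α := mul_le_mul_of_nonneg_right (hC ⟨n, rfl⟩) (by positivity)
  simp only [Pi.sub_apply]
  rw [sub_sub_sub_comm, add_mul]
  exact (abs_sub _ _).trans (add_le_add (h1.trans h3) h2)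

/-- Almost surely, approximate minimisers that lie in a compact set are eventually close to the
true parameter. -/
lemma ae_eventually_dist_lt (hp : ∀ θ, IsAdmissibleDensity (p θ))
    (hident : ∀ θ, (∀ x : ℝ, 0 < x → p θ x = p θ₀ x) → θ = θ₀) (hR3 : ScoreHoelder p θ₀)
    (hXmeas : ∀ j, Measurable (X j)) (hXindep : iIndepFun X P)
    (hXlaw : ∀ j, P.map (X j) = halfLineLaw (p θ₀))
    {q : ℝ} (hq : 1 ≤ q) (hwpos : ∀ t : ℝ, 0 < t → 0 < w t) (hwint : IntegrableOn w (Ioi 0))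
    {ε : ℕ → Ω → ℝ} (hεlim : ∀ᵐ ω ∂P, Tendsto (fun n => ε n ω) atTop (𝓝 0)) {est : ℕ → Ω → T}
    (hest : ∀ n, 1 ≤ n → ∀ᵐ ω ∂P,
      empiricalPsi p q w (fun j => X j ω) n (est n ω)
        ≤ (⨅ θ : T, empiricalPsi p q w (fun j => X j ω) n θ) + ε n ω)
    {K : Set T} (hK : IsCompact K) :
    ∀ᵐ ω ∂P, ∀ ρ > 0, ∀ᶠ n in atTop, est n ω ∈ K → dist (est n ω) θ₀ < ρ := by
  have hwm : AEMeasurable w (volume.restrict (Ioi 0)) := hwint.aestronglyMeasurable.aemeasurable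
  have hfin : IsFiniteMeasure (halfLineLaw w) := isFiniteMeasure_withDensity_ofReal hwint.2
  have hr : 1 ≤ ENNReal.ofReal q := by simpa using hq
  have hi := hR3.integrable_scoreQuot_mul_id hp
  -- The point θ₀ is added to K because the minimiser is compared with it and it need not lie in K.
  filter_upwards [ae_eventually_forall_lpNorm_empiricalEta_sub_lt (w := w) hp hR3 hXmeas hXindep
    hXlaw hr ENNReal.ofReal_ne_top (hK.insert θ₀), hεlim,
    ae_all_iff.mpr fun n => ae_all_iff.mpr (hest n),
    ae_forall_sample hXmeas hXlaw (halfLineLaw_ae_pos (p θ₀))] with ω hunif hε hmin hpos ρ hρ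
  obtain ⟨c, hc, hcle⟩ := exists_pos_le_lpNorm_populationEta hp hident hR3 hwm hwpos hr hK hρ
  -- Three errors, each below c / 3, contradict the lower bound c: the uniform error at the
  -- estimator, the one at θ₀, and the tolerance.
  filter_upwards [hunif (c / 3) (by positivity), hε.eventually (gt_mem_nhds (by positivity :
    0 < c / 3)), eventually_ge_atTop 1] with n hn hεn hn1 hmem
  by_contra! hge
  have hψ : ∀ θ, empiricalPsi p q w (fun j => X j ω) n θ
      = lpNorm (empiricalEta (p θ) (fun j => X j ω) n) (ENNReal.ofReal q) (halfLineLaw w) :=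
    fun θ => weightedLqNorm_eq_lpNorm hq hwm hwpos
      (measurable_empiricalEta _ _ _).aestronglyMeasurable
  have hinf : (⨅ θ : T, empiricalPsi p q w (fun j => X j ω) n θ)
      ≤ empiricalPsi p q w (fun j => X j ω) n θ₀ :=
    ciInf_le ⟨0, by rintro _ ⟨θ, rfl⟩; simp only [hψ]; exact lpNorm_nonneg⟩ θ₀
  have h1 := hcle _ hmem hge
  have h2 := hn _ (mem_insert_of_mem θ₀ hmem)
  have h3 := hn _ (mem_insert θ₀ K)
  have h4 := hmin n hn1
  have h5 := lpNorm_le_lpNorm_add_lpNorm_sub (memLp_empiricalEta (w := w) (p (est n ω)) hpos n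
    (ENNReal.ofReal q)) hr (f := populationEta (p (est n ω)) (halfLineLaw (p θ₀)))
  have h6 : lpNorm (empiricalEta (p θ₀) (fun j => X j ω) n) (ENNReal.ofReal q) (halfLineLaw w)
      = lpNorm (empiricalEta (p θ₀) (fun j => X j ω) n
        - populationEta (p θ₀) (halfLineLaw (p θ₀))) (ENNReal.ofReal q) (halfLineLaw w) := by
    rw [← toReal_eLpNorm (measurable_empiricalEta _ _ _).aestronglyMeasurable, ← toReal_eLpNorm
      ((measurable_empiricalEta _ _ _).aestronglyMeasurable.sub
        (aestronglyMeasurable_populationEta (hp θ₀) _ _))]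
    congr 1
    refine eLpNorm_congr_ae ?_
    filter_upwards [halfLineLaw_ae_pos w] with t ht
    simp [(hp θ₀).populationEta_self ht]
  rw [hψ] at h4 hinf
  linarith

end Consistency

end

/-! ### From compact sets to both modes of convergence -/

theorem theorem4p2
    {Ω : Type*} [MeasurableSpace Ω] (P : Measure Ω) [IsProbabilityMeasure P] [P.IsComplete]
    {d : ℕ} (Θ : Set (EuclideanSpace ℝ (Fin d)))
    -- the parametric family of densities on the positive half axis
    (p : Θ → ℝ → ℝ) (hp : ∀ θ : Θ, IsAdmissibleDensity (p θ))
    -- the true parameter, identifiable within the family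
    (θ₀ : Θ) (hident : ∀ θ : Θ, (∀ x : ℝ, 0 < x → p θ x = p θ₀ x) → θ = θ₀)
    -- the i.i.d. sample
    (X : ℕ → Ω → ℝ) (hXmeas : ∀ j, Measurable (X j)) (hXindep : iIndepFun X P)
    (hXlaw : ∀ j, P.map (X j) = halfLineLaw (p θ₀))
    -- the exponent and the weight function
    (q : ℝ) (hq : 1 ≤ q) (w : ℝ → ℝ) (hwpos : ∀ t : ℝ, 0 < t → 0 < w t)
    (hwint : IntegrableOn w (Ioi 0))
    -- the regularity conditions
    (hR1 : ScoreContinuous p) (hR2 : MeasurableSet Θ) (hR3 : ScoreHoelder p θ₀)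
    -- the tolerances
    (ε : ℕ → Ω → ℝ) (hεmeas : ∀ n, Measurable (ε n)) (hεpos : ∀ n ω, 0 < ε n ω)
    (hεlim : ∀ᵐ ω ∂P, Tendsto (fun n => ε n ω) atTop (𝓝 0))
    -- the measurable approximate minimisers
    (est : ℕ → Ω → Θ) (hestmeas : ∀ n, Measurable (est n))
    (hest : ∀ n, 1 ≤ n → ∀ᵐ ω ∂P,
      empiricalPsi p q w (fun j => X j ω) n (est n ω)
        ≤ (⨅ θ : Θ, empiricalPsi p q w (fun j => X j ω) n θ) + ε n ω) :
    (IsTightMeasureSet ((fun n => P.map (est n)) '' Ici 1) →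
      TendstoInMeasure P est atTop (fun _ => θ₀)) ∧
    (IsCompact Θ → ∀ᵐ ω ∂P, Tendsto (fun n => est n ω) atTop (𝓝 θ₀)) := by
  have hmain := fun K : Set Θ => ae_eventually_dist_lt (K := K) hp hident hR3 hXmeas hXindep hXlaw
    hq hwpos hwint hεlim hest
  refine ⟨fun htight => ?_, fun hΘ => ?_⟩
  · rw [tendstoInMeasure_iff_dist]
    intro ρ hρ
    rw [ENNReal.tendsto_atTop_zero]
    intro δ hδ
    obtain ⟨K, hK, hKδ⟩ := isTightMeasureSet_iff_exists_isCompact_measure_compl_le.mp htight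
      (δ / 2) (ENNReal.half_pos hδ.ne')
    classical
    -- Resetting the estimator to θ₀ outside K gives almost sure convergence, hence convergence in
    -- probability; the reset changes it only on an event of probability at most δ / 2.
    have hm : ∀ n, Measurable fun ω => if est n ω ∈ K then est n ω else θ₀ := fun n =>
      Measurable.ite (hestmeas n hK.measurableSet) (hestmeas n) measurable_const
    have hconv : TendstoInMeasure P (fun n ω => if est n ω ∈ K then est n ω else θ₀) atTop
        (fun _ => θ₀) := by
      refine tendstoInMeasure_of_tendsto_ae (fun n => (hm n).aestronglyMeasurable) ?_
      filter_upwards [hmain K hK] with ω hω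
      refine Metric.tendsto_nhds.mpr fun r hr => ?_
      filter_upwards [hω r hr] with n hn
      split_ifs with h
      · exact hn h
      · simpa using hr
    rw [tendstoInMeasure_iff_dist] at hconv
    obtain ⟨N, hN⟩ := ENNReal.tendsto_atTop_zero.mp (hconv ρ hρ) (δ / 2) (ENNReal.half_pos hδ.ne')
    -- Tightness is assumed only for n ≥ 1.
    refine ⟨max N 1, fun n hn => ?_⟩
    have h1 := hN n ((le_max_left _ _).trans hn)
    have h2 : P (est n ⁻¹' Kᶜ) ≤ δ / 2 := by
      rw [← Measure.map_apply (hestmeas n) hK.measurableSet.compl]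
      exact hKδ _ ⟨n, (le_max_right _ _).trans hn, rfl⟩
    rw [← ENNReal.add_halves δ]
    refine (measure_mono fun ω hω => ?_).trans ((measure_union_le _ _).trans (add_le_add h1 h2))
    by_cases h : est n ω ∈ K
    · left; simpa [h] using hω
    · right; exact h
  · filter_upwards [hmain univ (isCompact_iff_isCompact_univ.mp hΘ)] with ω hω
    refine Metric.tendsto_nhds.mpr fun r hr => ?_
    filter_upwards [hω r hr] with n hn using hn (mem_univ _)
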